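/- Let $(X,d)$ be a complete separable metric space and let $\mathfrak m$ be a Radon measure on $X$ such that $0<\mathfrak m(U)<+\infty$ for every non-empty bounded open set $U\subset X$. Write $B_r(x)=\{y\in X: d(x,y)<r\}$ and $d_{x_0}(x)=d(x_0,x)$, and, for $u:X\to\mathbb R$, let $\operatorname{lip}u(x)=\limsup_{y\to x,\,y\ne x}\frac{|u(y)-u(x)|}{d(y,x)}$ denote the local Lipschitz constant (equal to $0$ at isolated points). Fix $x_0\in X$, and let $\beta,\gamma>0$, $D\ge 1$ and $C>0$. Suppose that the following three conditions hold. 1. (Caffarelli--Kohn--Nirenberg inequalities, with constants uniform in $k$) For every integer $k\ge 0$ and every Lipschitz function $u:X\to\mathbb R$ with bounded support, $$\left(\int_X d_{x_0}^{2k}\,|\operatorname{lip}u|^2\,d\mathfrak m\right)\left(\int_X d_{x_0}^{2k+2}\,|u|^2\,d\mathfrak m\right)\ \ge\ (C+k)^2\left(\int_X d_{x_0}^{2k}\,|u|^2\,d\mathfrak m\right)^2 .$$ 2. For all $x\in X$ and $0<r<R$, $$\frac{\mathfrak m(B_R(x))}{R^\gamma}\ \le\ D\,\frac{\mathfrak m(B_r(x))}{r^\gamma}.$$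 3. $\displaystyle\liminf_{r\to0^+}\frac{\mathfrak m(B_r(x_0))}{r^\beta}=c_*$ for some $c_*\in(0,+\infty)$. Then $2C\le\beta\le\gamma$, and there exists a constant $C_*>0$ such that, for all $r>0$ and all $x\in X$, $$\frac{\mathfrak m(B_r(x))}{r^\beta}\ \ge\ C_*\,\frac{1}{(1+r+d(x_0,x))^{\beta-2C}}\cdot\frac{1}{\left(1+\frac{d(x_0,x)}{r}\right)^{\gamma-\beta}} .$$ -/

import Mathlib

open Filter Topology MeasureTheory
open scoped ENNReal

namespace MMS

/-- The condition on a Borel measure `m` on a complete separable metric space `X` that makes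
`(X, d, m)` a metric measure space: non-empty bounded open sets have positive finite measure.
(Such a measure is locally finite, hence it is automatically a Radon measure.) -/
structure IsMetricMeasure {X : Type*} [MetricSpace X] [MeasurableSpace X]
    (m : Measure X) : Prop where
  pos : ∀ U : Set X, IsOpen U → U.Nonempty → Bornology.IsBounded U → 0 < m U
  lt_top : ∀ U : Set X, IsOpen U → U.Nonempty → Bornology.IsBounded U → m U < ∞

/-- The class of Lipschitz functions `u : X → ℝ` with bounded support. -/
def LipB (X : Type*) [MetricSpace X] : Set (X → ℝ) :=
  {u | (∃ K : NNReal, LipschitzWith K u) ∧ Bornology.IsBounded (Function.support u)}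

/-- The local Lipschitz constant `lip u (x) = limsup_{y → x} |u y - u x| / d(y, x)`, where `y`
ranges over the points different from `x`; it is `0` at isolated points. -/
noncomputable def lip {X : Type*} [MetricSpace X] (u : X → ℝ) (x : X) : ℝ≥0∞ :=
  limsup (fun y => edist (u y) (u x) / edist y x) (𝓝[≠] x)

/-- The inequality `(CKN)_{C, x₀, k}`: for all Lipschitz `u` with bounded support,
`(∫ d_{x₀}^{2k} |lip u|² dm) (∫ d_{x₀}^{2k+2} |u|² dm) ≥ (C + k)² (∫ d_{x₀}^{2k} |u|² dm)²`.
The integrands are non-negative; the integrals are taken with values in `[0, ∞]`. -/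
def CKN {X : Type*} [MetricSpace X] [MeasurableSpace X] (m : Measure X)
    (C : ℝ) (x₀ : X) (k : ℕ) : Prop :=
  ∀ u ∈ LipB X,
    (∫⁻ x, edist x₀ x ^ (2 * k) * lip u x ^ 2 ∂m) *
        (∫⁻ x, edist x₀ x ^ (2 * k + 2) * ‖u x‖ₑ ^ 2 ∂m) ≥
      ENNReal.ofReal ((C + k) ^ 2) * (∫⁻ x, edist x₀ x ^ (2 * k) * ‖u x‖ₑ ^ 2 ∂m) ^ 2

/-- The volume growth condition `(VD)_{D, γ}`:
`m(B_R(x)) / R^γ ≤ D · m(B_r(x)) / r^γ` for all `x` and `0 < r < R`. -/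
def VD {X : Type*} [MetricSpace X] [MeasurableSpace X] (m : Measure X) (D γ : ℝ) : Prop :=
  ∀ (r R : ℝ) (x : X), 0 < r → r < R →
    m.real (Metric.ball x R) / R ^ γ ≤ D * (m.real (Metric.ball x r) / r ^ γ)

/-- The condition `(AR)_{x₀, β, c}`: `c ∈ (0, ∞)` and
`liminf_{r → 0+} m(B_r(x₀)) / r^β = c`, the lower limit being taken in `[0, ∞]`. -/
def AR {X : Type*} [MetricSpace X] [MeasurableSpace X] (m : Measure X)
    (x₀ : X) (β c : ℝ) : Prop :=
  0 < c ∧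
    liminf (fun r : ℝ => m (Metric.ball x₀ r) / ENNReal.ofReal (r ^ β)) (𝓝[>] 0) =
      ENNReal.ofReal c

end MMS

/-!
Put `F l = ∫ exp (-l d_{x₀}²)`. Tested on the Gaussian `exp (-l d_{x₀}² / 2)`, whose local Lipschitz
constant is at most `l d_{x₀}` times itself, the Caffarelli--Kohn--Nirenberg
inequality with `k = 0` becomes `C F ≤ -l F'`
(`CKN.mul_integral_gaussian_le`), so `l ^ C * F l` is antitone
(`antitoneOn_rpow_mul_integral_gaussian`). Volume growth makes `F (r⁻²)` comparable with the mass
`V r` of the ball of radius `r` around `x₀` (`real_ball_le_exp_mul_integral_gaussian`,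
`VD.integral_gaussian_le`). Together these give `V r ≤ K (r / s) ^ (2 C) V s` for `r ≤ s`
(`exists_real_ball_le_mul_rpow_mul_real_ball`).

For `r → 0` and `s = 1` this is an upper bound on `V r`, and it meets the lower bound
`V r ≥ (c / 2) r ^ β` only if `2 C ≤ β`. For `r` fixed and `s → ∞` it is a lower bound of order
`s ^ (2 C)`, which joins with `(c / 2) r ^ β` near `0` to give the claim for balls around `x₀`
(`exists_le_real_ball_self`). Likewise volume growth gives `V r ≥ const * r ^ γ` for `r < 1`, while
`V r ≤ 2 c r ^ β` for arbitrarily small `r`, so `β ≤ γ`. For a ball around another point `x`, volume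
growth compares radius `r` with radius `2 (r + d(x₀, x))`, at which the ball around `x` contains the
ball of radius `r + d(x₀, x)` around `x₀`.
-/

namespace MMS

/-! ### Truncated Gaussians and their local Lipschitz constants -/

section

variable {X : Type*} [MetricSpace X]

/-- Allowing `u` to vary less than `g ∘ d_{x₀}`, rather than to equal it, covers the truncations of
`g ∘ d_{x₀}`, which need not be differentiable in `d_{x₀}`. -/
lemma lip_le_of_hasDerivAt {u : X → ℝ} {g : ℝ → ℝ} {g' : ℝ} {x₀ x : X}
    (hu : ∀ y, |u y - u x| ≤ |g (dist x₀ y) - g (dist x₀ x)|)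
    (hg : HasDerivAt g g' (dist x₀ x)) : lip u x ≤ ENNReal.ofReal |g'| := by
  refine ENNReal.le_of_forall_pos_le_add fun ε hε _ => ?_
  have hlo := (hasDerivAt_iff_isLittleO.1 hg).def (c := (ε : ℝ)) (by exact_mod_cast hε)
  have hcont : Tendsto (fun y : X => dist x₀ y) (𝓝[≠] x) (𝓝 (dist x₀ x)) :=
    ((continuous_const.dist continuous_id).tendsto x).mono_left nhdsWithin_le_nhds
  refine limsup_le_of_le (by isBoundedDefault) ?_
  filter_upwards [hcont.eventually hlo] with y hy
  refine ENNReal.div_le_of_le_mul ?_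
  have h1 : |u y - u x| ≤ (|g'| + ε) * dist y x := by
    refine (hu y).trans ?_
    simp only [smul_eq_mul, Real.norm_eq_abs] at hy
    have h2 : |dist x₀ y - dist x₀ x| ≤ dist y x := by
      rw [dist_comm x₀ y, dist_comm x₀ x]; exact abs_dist_sub_le y x x₀
    have h3 := abs_sub_abs_le_abs_sub (g (dist x₀ y) - g (dist x₀ x))
      ((dist x₀ y - dist x₀ x) * g')
    rw [abs_mul] at h3
    have h4 : 0 ≤ |g'| + ε := by positivity
    nlinarith [mul_le_mul_of_nonneg_left h2 h4]
  have h5 : ENNReal.ofReal |g'| + (ε : ℝ≥0∞) = ENNReal.ofReal (|g'| + ε) := by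
    rw [ENNReal.ofReal_add (abs_nonneg _) ε.coe_nonneg, ENNReal.ofReal_coe_nnreal]
  rw [h5, edist_dist, edist_dist, Real.dist_eq, ← ENNReal.ofReal_mul (by positivity)]
  exact ENNReal.ofReal_le_ofReal h1

lemma hasDerivAt_exp_neg_half_mul_sq (l t : ℝ) :
    HasDerivAt (fun s : ℝ => Real.exp (-(l / 2) * s ^ 2))
      (-(l * t * Real.exp (-(l / 2) * t ^ 2))) t := by
  convert ((hasDerivAt_pow 2 t).const_mul (-(l / 2))).exp using 1
  push_cast
  ring

lemma lipschitzWith_exp_neg_half_mul_sq {l : ℝ} (hl : 0 < l) :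
    LipschitzWith (l + 2).toNNReal (fun s : ℝ => Real.exp (-(l / 2) * s ^ 2)) := by
  refine lipschitzWith_of_nnnorm_deriv_le
    (fun t => (hasDerivAt_exp_neg_half_mul_sq l t).differentiableAt) fun t => ?_
  rw [(hasDerivAt_exp_neg_half_mul_sq l t).deriv, ← NNReal.coe_le_coe, coe_nnnorm,
    Real.coe_toNNReal _ (by positivity), norm_neg, Real.norm_eq_abs, abs_mul, Real.abs_exp,
    abs_mul, abs_of_pos hl]
  have h1 : 1 + l / 2 * t ^ 2 ≤ Real.exp (l / 2 * t ^ 2) := by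
    linarith [Real.add_one_le_exp (l / 2 * t ^ 2)]
  rw [neg_mul, Real.exp_neg, ← div_eq_mul_inv, div_le_iff₀ (Real.exp_pos _)]
  refine le_trans ?_ (mul_le_mul_of_nonneg_left h1 (by positivity))
  have h2 : |t| ≤ 1 + t ^ 2 := by
    rw [← sq_abs]; nlinarith [sq_nonneg (|t| - 1), abs_nonneg t]
  nlinarith [mul_le_mul_of_nonneg_left h2 hl.le, mul_nonneg hl.le (sq_nonneg t),
    mul_nonneg hl.le (mul_nonneg hl.le (sq_nonneg t))]

/-- The Gaussian `exp (-l d_{x₀}² / 2)` lowered by `1 / (n + 1)` and cut off at zero, which makes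
its support bounded without enlarging its local Lipschitz constant. -/
noncomputable def truncGaussian (x₀ : X) (l : ℝ) (n : ℕ) (x : X) : ℝ :=
  max (Real.exp (-(l / 2) * dist x₀ x ^ 2) - 1 / (n + 1)) 0

lemma truncGaussian_mem_lipB (x₀ : X) {l : ℝ} (hl : 0 < l) (n : ℕ) :
    truncGaussian x₀ l n ∈ LipB X := by
  constructor
  · have h1 := (lipschitzWith_exp_neg_half_mul_sq hl).comp (LipschitzWith.dist_right x₀)
    have h2 := h1.sub (LipschitzWith.const (α := X) (1 / ((n : ℝ) + 1)))
    exact ⟨_, h2.max_const 0⟩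
  · refine (Metric.isBounded_ball (x := x₀) (r := 1 + 2 * n / l)).subset fun x hx => ?_
    have h0 : 1 / ((n : ℝ) + 1) < Real.exp (-(l / 2) * dist x₀ x ^ 2) := by
      by_contra h
      exact hx (max_eq_right (by linarith [not_lt.1 h]))
    rw [Metric.mem_ball, dist_comm]
    rw [neg_mul, Real.exp_neg, one_div, inv_lt_inv₀ (by positivity) (Real.exp_pos _)] at h0
    have h1 := Real.add_one_le_exp (l / 2 * dist x₀ x ^ 2)
    have h2 : dist x₀ x ^ 2 < 2 * n / l := by
      rw [lt_div_iff₀ hl]; nlinarith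
    nlinarith [sq_nonneg (dist x₀ x - 1), dist_nonneg (x := x₀) (y := x)]

lemma lip_truncGaussian_le (x₀ : X) {l : ℝ} (hl : 0 < l) (n : ℕ) (x : X) :
    lip (truncGaussian x₀ l n) x ≤
      ENNReal.ofReal (l * dist x₀ x * Real.exp (-(l / 2) * dist x₀ x ^ 2)) := by
  have h := lip_le_of_hasDerivAt (u := truncGaussian x₀ l n) (x₀ := x₀) (x := x)
    (fun y => ?_) (hasDerivAt_exp_neg_half_mul_sq l (dist x₀ x))
  · rwa [abs_neg, abs_of_nonneg (by positivity)] at h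
  · refine (abs_max_sub_max_le_abs _ _ _).trans (le_of_eq ?_)
    congr 1
    ring

lemma truncGaussian_nonneg (x₀ : X) (l : ℝ) (n : ℕ) (x : X) : 0 ≤ truncGaussian x₀ l n x :=
  le_max_right _ _

lemma truncGaussian_le (x₀ : X) (l : ℝ) (n : ℕ) (x : X) :
    truncGaussian x₀ l n x ≤ Real.exp (-(l / 2) * dist x₀ x ^ 2) := by
  refine max_le ?_ (Real.exp_pos _).le
  have : (0 : ℝ) ≤ 1 / ((n : ℝ) + 1) := by positivity
  linarith

lemma tendsto_truncGaussian (x₀ : X) (l : ℝ) (x : X) :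
    Tendsto (fun n => truncGaussian x₀ l n x) atTop (𝓝 (Real.exp (-(l / 2) * dist x₀ x ^ 2))) := by
  have h := ((tendsto_const_nhds (x := Real.exp (-(l / 2) * dist x₀ x ^ 2))).sub
    (tendsto_one_div_add_atTop_nhds_zero_nat (𝕜 := ℝ))).max (tendsto_const_nhds (x := (0 : ℝ)))
  rwa [sub_zero, max_eq_left (Real.exp_pos _).le] at h

lemma exp_half_sq (l t : ℝ) : Real.exp (-(l / 2) * t ^ 2) ^ 2 = Real.exp (-l * t ^ 2) := by
  rw [← Real.exp_nat_mul]; congr 1; push_cast; ring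

end

/-! ### Gaussian integrals under volume growth -/

section

variable {X : Type*} [MetricSpace X] [MeasurableSpace X] {m : Measure X}

lemma IsMetricMeasure.ball_lt_top (hm : IsMetricMeasure m) (x : X) (r : ℝ) :
    m (Metric.ball x r) < ∞ := by
  rcases le_or_gt r 0 with hr | hr
  · simp [Metric.ball_eq_empty.2 hr]
  · exact hm.lt_top _ Metric.isOpen_ball ⟨x, Metric.mem_ball_self hr⟩ Metric.isBounded_ball

lemma IsMetricMeasure.real_ball_pos (hm : IsMetricMeasure m) (x : X) {r : ℝ} (hr : 0 < r) :
    0 < m.real (Metric.ball x r) :=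
  ENNReal.toReal_pos
    (hm.pos _ Metric.isOpen_ball ⟨x, Metric.mem_ball_self hr⟩ Metric.isBounded_ball).ne'
    (hm.ball_lt_top x r).ne

lemma IsMetricMeasure.real_ball_mono (hm : IsMetricMeasure m) {x y : X} {r s : ℝ}
    (h : Metric.ball x r ⊆ Metric.ball y s) :
    m.real (Metric.ball x r) ≤ m.real (Metric.ball y s) :=
  measureReal_mono h (hm.ball_lt_top y s).ne

lemma VD.le_mul {D γ : ℝ} (h : VD m D γ) (x : X) {r R : ℝ} (hr : 0 < r) (hR : r < R) :
    m.real (Metric.ball x R) ≤ D * (R / r) ^ γ * m.real (Metric.ball x r) := by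
  have hR0 := hr.trans hR
  have h1 := h r R x hr hR
  rw [div_le_iff₀ (Real.rpow_pos_of_pos hR0 γ)] at h1
  rw [Real.div_rpow hR0.le hr.le]
  refine h1.trans (le_of_eq ?_)
  ring

lemma summable_exp_neg_sq_mul_rpow (γ : ℝ) :
    Summable fun n : ℕ => Real.exp (-(n : ℝ) ^ 2) * ((n : ℝ) + 1) ^ γ := by
  obtain ⟨k, hk⟩ := exists_nat_ge γ
  have h := (summable_nat_add_iff 1).2 (Real.summable_pow_mul_exp_neg_nat_mul k one_pos)
  refine Summable.of_nonneg_of_le (fun n => by positivity) (fun n => ?_) (h.mul_left (Real.exp 1))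
  have h1 : ((n : ℝ) + 1) ^ γ ≤ ((n : ℝ) + 1) ^ k := by
    rw [← Real.rpow_natCast]
    exact Real.rpow_le_rpow_of_exponent_le (by linarith [n.cast_nonneg (α := ℝ)]) hk
  have h2 : Real.exp (-(n : ℝ) ^ 2) ≤ Real.exp 1 * Real.exp (-1 * ((n : ℝ) + 1)) := by
    rw [← Real.exp_add]
    refine Real.exp_le_exp.2 ?_
    have : (n : ℝ) ≤ (n : ℝ) ^ 2 := by exact_mod_cast Nat.le_self_pow two_ne_zero n
    linarith
  push_cast
  calc _ ≤ Real.exp 1 * Real.exp (-1 * ((n : ℝ) + 1)) * ((n : ℝ) + 1) ^ k := by gcongr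
    _ = _ := by ring

variable [BorelSpace X]

lemma measurable_dist_left (x₀ : X) : Measurable fun x : X => dist x₀ x :=
  (continuous_const.dist continuous_id).measurable

/-- Volume growth makes the Gaussian of width `r` weigh no more than a fixed multiple of the ball
of radius `r`: on the shell `n r ≤ d_{x₀} < (n + 1) r` it is at most `exp (-n²)`, while the ball of
radius `(n + 1) r` has at most `D (n + 1) ^ γ` times the mass of the ball of radius `r`. -/
lemma VD.lintegral_gaussian_le {D γ : ℝ} (h : VD m D γ) (hm : IsMetricMeasure m) (hD : 1 ≤ D)
    (x₀ : X) {r : ℝ} (hr : 0 < r) :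
    ∫⁻ x, ENNReal.ofReal (Real.exp (-(dist x₀ x / r) ^ 2)) ∂m ≤
      ENNReal.ofReal ((∑' n : ℕ, Real.exp (-(n : ℝ) ^ 2) * ((n : ℝ) + 1) ^ γ) * D *
        m.real (Metric.ball x₀ r)) := by
  have hpt : ∀ x, ENNReal.ofReal (Real.exp (-(dist x₀ x / r) ^ 2)) ≤
      ∑' n : ℕ, (Metric.ball x₀ ((n + 1) * r)).indicator
        (fun _ => ENNReal.ofReal (Real.exp (-(n : ℝ) ^ 2))) x := by
    intro x
    set n := ⌊dist x₀ x / r⌋₊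
    have h0 : 0 ≤ dist x₀ x / r := by positivity
    refine le_trans ?_ (ENNReal.le_tsum n)
    have hmem : x ∈ Metric.ball x₀ ((n + 1) * r) := by
      rw [Metric.mem_ball, dist_comm, ← div_lt_iff₀ hr]
      exact Nat.lt_floor_add_one _
    rw [Set.indicator_of_mem hmem]
    refine ENNReal.ofReal_le_ofReal (Real.exp_le_exp.2 (neg_le_neg ?_))
    exact pow_le_pow_left₀ n.cast_nonneg (Nat.floor_le h0) 2
  have hball : ∀ n : ℕ, m.real (Metric.ball x₀ ((n + 1) * r)) ≤
      D * ((n : ℝ) + 1) ^ γ * m.real (Metric.ball x₀ r) := by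
    intro n
    rcases Nat.eq_zero_or_pos n with rfl | hn
    · simpa using le_mul_of_one_le_left measureReal_nonneg hD
    · have hn' : (0 : ℝ) < n := by exact_mod_cast hn
      have := h.le_mul x₀ hr (R := (n + 1) * r) (by nlinarith)
      rwa [mul_div_cancel_right₀ _ hr.ne'] at this
  have hD0 : 0 ≤ D := by linarith
  calc _ ≤ ∫⁻ x, ∑' n : ℕ, (Metric.ball x₀ ((n + 1) * r)).indicator
        (fun _ => ENNReal.ofReal (Real.exp (-(n : ℝ) ^ 2))) x ∂m := lintegral_mono hpt
    _ = ∑' n : ℕ, ENNReal.ofReal (Real.exp (-(n : ℝ) ^ 2)) * m (Metric.ball x₀ ((n + 1) * r)) := by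
        rw [lintegral_tsum fun n =>
          (measurable_const.indicator Metric.isOpen_ball.measurableSet).aemeasurable]
        simp_rw [lintegral_indicator_const Metric.isOpen_ball.measurableSet]
    _ ≤ ∑' n : ℕ, ENNReal.ofReal (Real.exp (-(n : ℝ) ^ 2) * ((n : ℝ) + 1) ^ γ *
          (D * m.real (Metric.ball x₀ r))) := by
        refine ENNReal.tsum_le_tsum fun n => ?_
        rw [← ofReal_measureReal (hm.ball_lt_top _ _).ne, ← ENNReal.ofReal_mul (Real.exp_pos _).le]
        refine ENNReal.ofReal_le_ofReal ?_
        calc _ ≤ Real.exp (-(n : ℝ) ^ 2) * (D * ((n : ℝ) + 1) ^ γ * m.real (Metric.ball x₀ r)) := by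
              gcongr; exact hball n
          _ = _ := by ring
    _ = _ := by
        rw [← ENNReal.ofReal_tsum_of_nonneg (fun n => by positivity)
          ((summable_exp_neg_sq_mul_rpow γ).mul_right _), tsum_mul_right, mul_assoc]

lemma VD.integrable_gaussian {D γ : ℝ} (h : VD m D γ) (hm : IsMetricMeasure m) (hD : 1 ≤ D)
    (x₀ : X) {l : ℝ} (hl : 0 < l) :
    Integrable (fun x => Real.exp (-l * dist x₀ x ^ 2)) m := by
  have hmeas : Measurable fun x => Real.exp (-l * dist x₀ x ^ 2) :=
    (((measurable_dist_left x₀).pow_const 2).const_mul _).exp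
  refine ⟨hmeas.aestronglyMeasurable, ?_⟩
  rw [hasFiniteIntegral_iff_ofReal (ae_of_all _ fun x => (Real.exp_pos _).le)]
  have h1 := h.lintegral_gaussian_le hm hD x₀ (r := (√l)⁻¹) (by positivity)
  refine lt_of_le_of_lt (le_of_eq ?_) (h1.trans_lt ENNReal.ofReal_lt_top)
  congr! 4 with x
  rw [div_inv_eq_mul, mul_pow, Real.sq_sqrt hl.le]
  ring

lemma sq_mul_exp_neg_le {l : ℝ} (hl : 0 < l) (t : ℝ) :
    t ^ 2 * Real.exp (-l * t ^ 2) ≤ 2 / l * Real.exp (-(l / 2) * t ^ 2) := by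
  have h1 : Real.exp (-l * t ^ 2) = Real.exp (-(l / 2) * t ^ 2) * Real.exp (-(l / 2 * t ^ 2)) := by
    rw [← Real.exp_add]; congr 1; ring
  have h2 : t ^ 2 * Real.exp (-(l / 2 * t ^ 2)) ≤ 2 / l := by
    rw [Real.exp_neg, ← div_eq_mul_inv, div_le_div_iff₀ (Real.exp_pos _) hl]
    nlinarith [Real.add_one_le_exp (l / 2 * t ^ 2)]
  rw [h1]
  nlinarith [mul_le_mul_of_nonneg_right h2 (Real.exp_pos (-(l / 2) * t ^ 2)).le]

lemma VD.integrable_sq_mul_gaussian {D γ : ℝ} (h : VD m D γ) (hm : IsMetricMeasure m)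
    (hD : 1 ≤ D) (x₀ : X) {l : ℝ} (hl : 0 < l) :
    Integrable (fun x => dist x₀ x ^ 2 * Real.exp (-l * dist x₀ x ^ 2)) m := by
  have hd := (measurable_dist_left x₀).pow_const 2
  refine ((h.integrable_gaussian hm hD x₀ (half_pos hl)).const_mul (2 / l)).mono'
    (hd.mul (hd.const_mul _).exp).aestronglyMeasurable (ae_of_all _ fun x => ?_)
  rw [Real.norm_of_nonneg (by positivity)]
  exact sq_mul_exp_neg_le hl _

/-! ### The differential inequality for Gaussian integrals -/

/-- The Caffarelli--Kohn--Nirenberg inequality with `k = 0` on a Gaussian, the limit of the same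
inequality on truncated Gaussians. Since `lip exp (-l d_{x₀}² / 2) ≤ l d_{x₀} exp (-l d_{x₀}² / 2)`,
both factors of its left-hand side are multiples of the same integral. -/
lemma CKN.mul_integral_gaussian_le {C : ℝ} {x₀ : X} (h : CKN m C x₀ 0) (hC : 0 < C) {l : ℝ}
    (hl : 0 < l) (hi : Integrable (fun x => Real.exp (-l * dist x₀ x ^ 2)) m)
    (hi₂ : Integrable (fun x => dist x₀ x ^ 2 * Real.exp (-l * dist x₀ x ^ 2)) m) :
    C * ∫ x, Real.exp (-l * dist x₀ x ^ 2) ∂m ≤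
      l * ∫ x, dist x₀ x ^ 2 * Real.exp (-l * dist x₀ x ^ 2) ∂m := by
  set I := ∫ x, Real.exp (-l * dist x₀ x ^ 2) ∂m
  set A := ∫ x, dist x₀ x ^ 2 * Real.exp (-l * dist x₀ x ^ 2) ∂m
  have hI0 : 0 ≤ I := integral_nonneg fun x => by positivity
  have hA0 : 0 ≤ A := integral_nonneg fun x => by positivity
  have hI : ∫⁻ x, ENNReal.ofReal (Real.exp (-l * dist x₀ x ^ 2)) ∂m = ENNReal.ofReal I :=
    (ofReal_integral_eq_lintegral_ofReal hi (ae_of_all _ fun x => by positivity)).symm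
  have hA : ∫⁻ x, ENNReal.ofReal (dist x₀ x ^ 2 * Real.exp (-l * dist x₀ x ^ 2)) ∂m =
      ENNReal.ofReal A :=
    (ofReal_integral_eq_lintegral_ofReal hi₂ (ae_of_all _ fun x => by positivity)).symm
  have hnorm : ∀ n x, ‖truncGaussian x₀ l n x‖ₑ ^ 2 =
      ENNReal.ofReal (truncGaussian x₀ l n x ^ 2) := fun n x => by
    rw [Real.enorm_of_nonneg (truncGaussian_nonneg _ _ _ _),
      ENNReal.ofReal_pow (truncGaussian_nonneg _ _ _ _)]
  have hsq : ∀ n x, truncGaussian x₀ l n x ^ 2 ≤ Real.exp (-l * dist x₀ x ^ 2) := fun n x => by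
    rw [← exp_half_sq]
    exact pow_le_pow_left₀ (truncGaussian_nonneg _ _ _ _) (truncGaussian_le _ _ _ _) 2
  have hmeas : ∀ n, Measurable fun x => ENNReal.ofReal (truncGaussian x₀ l n x ^ 2) := fun n =>
    ((((((measurable_dist_left x₀).pow_const 2).const_mul _).exp.sub_const _).max
      measurable_const).pow_const 2).ennreal_ofReal
  have hlim : Tendsto (fun n => ∫⁻ x, ENNReal.ofReal (truncGaussian x₀ l n x ^ 2) ∂m) atTop
      (𝓝 (ENNReal.ofReal I)) := by
    rw [← hI]
    refine tendsto_lintegral_of_dominated_convergence _ hmeas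
      (fun n => ae_of_all _ fun x => ENNReal.ofReal_le_ofReal (hsq n x))
      (by rw [hI]; exact ENNReal.ofReal_ne_top) (ae_of_all _ fun x => ?_)
    have := (tendsto_truncGaussian x₀ l x).pow 2
    rw [exp_half_sq] at this
    exact ENNReal.tendsto_ofReal this
  have hn : ∀ n, ENNReal.ofReal (C ^ 2) *
      (∫⁻ x, ENNReal.ofReal (truncGaussian x₀ l n x ^ 2) ∂m) ^ 2 ≤
        ENNReal.ofReal ((l * A) ^ 2) := by
    intro n
    have h1 := h _ (truncGaussian_mem_lipB x₀ hl n)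
    simp only [mul_zero, pow_zero, one_mul, Nat.cast_zero, add_zero, zero_add, hnorm] at h1
    refine h1.trans ?_
    have h2 : ∫⁻ x, lip (truncGaussian x₀ l n) x ^ 2 ∂m ≤ ENNReal.ofReal (l ^ 2 * A) := by
      rw [ENNReal.ofReal_mul (sq_nonneg l), ← hA, ← lintegral_const_mul' _ _ ENNReal.ofReal_ne_top]
      refine lintegral_mono fun x => ?_
      rw [← ENNReal.ofReal_mul (sq_nonneg l)]
      calc _ ≤ ENNReal.ofReal (l * dist x₀ x * Real.exp (-(l / 2) * dist x₀ x ^ 2)) ^ 2 := by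
            gcongr; exact lip_truncGaussian_le x₀ hl n x
        _ = _ := by
            rw [← ENNReal.ofReal_pow (by positivity), mul_pow, exp_half_sq, mul_pow, mul_assoc]
    have h3 : ∫⁻ x, edist x₀ x ^ 2 * ENNReal.ofReal (truncGaussian x₀ l n x ^ 2) ∂m ≤
        ENNReal.ofReal A := by
      rw [← hA]
      refine lintegral_mono fun x => ?_
      rw [edist_dist, ← ENNReal.ofReal_pow dist_nonneg, ← ENNReal.ofReal_mul (sq_nonneg _)]
      exact ENNReal.ofReal_le_ofReal (mul_le_mul_of_nonneg_left (hsq n x) (sq_nonneg _))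
    calc _ ≤ ENNReal.ofReal (l ^ 2 * A) * ENNReal.ofReal A := mul_le_mul' h2 h3
      _ = _ := by rw [← ENNReal.ofReal_mul (by positivity)]; congr 1; ring
  have hfin : ENNReal.ofReal ((C * I) ^ 2) ≤ ENNReal.ofReal ((l * A) ^ 2) := by
    rw [mul_pow, ENNReal.ofReal_mul (sq_nonneg C), ENNReal.ofReal_pow hI0]
    exact le_of_tendsto' (ENNReal.Tendsto.const_mul (ENNReal.Tendsto.pow hlim)
      (Or.inr ENNReal.ofReal_ne_top)) hn
  rw [ENNReal.ofReal_le_ofReal_iff (sq_nonneg _)] at hfin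
  exact (pow_le_pow_iff_left₀ (by positivity) (by positivity) two_ne_zero).1 hfin

lemma VD.hasDerivAt_integral_gaussian {D γ : ℝ} (h : VD m D γ) (hm : IsMetricMeasure m)
    (hD : 1 ≤ D) (x₀ : X) {l : ℝ} (hl : 0 < l) :
    HasDerivAt (fun s => ∫ x, Real.exp (-s * dist x₀ x ^ 2) ∂m)
      (-∫ x, dist x₀ x ^ 2 * Real.exp (-l * dist x₀ x ^ 2) ∂m) l := by
  have hd := (measurable_dist_left x₀).pow_const 2
  have key := hasDerivAt_integral_of_dominated_loc_of_deriv_le (μ := m) (x₀ := l)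
    (F := fun s x => Real.exp (-s * dist x₀ x ^ 2))
    (F' := fun s x => -(dist x₀ x ^ 2 * Real.exp (-s * dist x₀ x ^ 2)))
    (bound := fun x => dist x₀ x ^ 2 * Real.exp (-(l / 2) * dist x₀ x ^ 2))
    (s := Set.Ioi (l / 2)) (Ioi_mem_nhds (by linarith))
    (Eventually.of_forall fun s => (hd.const_mul _).exp.aestronglyMeasurable)
    (h.integrable_gaussian hm hD x₀ hl)
    (hd.mul (hd.const_mul _).exp).neg.aestronglyMeasurable
    (ae_of_all _ fun x s hs => ?_)
    (h.integrable_sq_mul_gaussian hm hD x₀ (half_pos hl))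
    (ae_of_all _ fun x s _ => ?_)
  · rw [← integral_neg]
    exact key.2
  · rw [norm_neg, Real.norm_of_nonneg (by positivity)]
    have : l / 2 < s := hs
    gcongr
  · exact ((hasDerivAt_neg s).mul_const (dist x₀ x ^ 2)).exp.congr_deriv (by ring)

/-- Integrating the differential inequality `-l F' ≥ C F` for `F l = ∫ exp (-l d_{x₀}²)`. -/
lemma antitoneOn_rpow_mul_integral_gaussian {D γ C : ℝ} {x₀ : X} (hVD : VD m D γ)
    (hm : IsMetricMeasure m) (hD : 1 ≤ D) (hC : 0 < C) (h : CKN m C x₀ 0) :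
    AntitoneOn (fun l : ℝ => l ^ C * ∫ x, Real.exp (-l * dist x₀ x ^ 2) ∂m) (Set.Ioi 0) := by
  have hder : ∀ l : ℝ, 0 < l → HasDerivAt
      (fun l : ℝ => l ^ C * ∫ x, Real.exp (-l * dist x₀ x ^ 2) ∂m)
      (C * l ^ (C - 1) * (∫ x, Real.exp (-l * dist x₀ x ^ 2) ∂m) +
        l ^ C * (-∫ x, dist x₀ x ^ 2 * Real.exp (-l * dist x₀ x ^ 2) ∂m)) l := fun l hl =>
    (Real.hasDerivAt_rpow_const (Or.inl hl.ne')).mul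
      (hVD.hasDerivAt_integral_gaussian hm hD x₀ hl)
  refine antitoneOn_of_deriv_nonpos (convex_Ioi 0)
    (fun l hl => (hder l hl).continuousAt.continuousWithinAt)
    (fun l hl => (hder l (interior_subset hl)).differentiableAt.differentiableWithinAt)
    fun l hl => ?_
  have hl0 : 0 < l := interior_subset hl
  rw [(hder l hl0).deriv]
  have h1 := h.mul_integral_gaussian_le hC hl0 (hVD.integrable_gaussian hm hD x₀ hl0)
    (hVD.integrable_sq_mul_gaussian hm hD x₀ hl0)
  have h2 : l ^ C = l ^ (C - 1) * l := by
    rw [← Real.rpow_add_one hl0.ne']; congr 1; ring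
  rw [h2]
  nlinarith [mul_le_mul_of_nonneg_left h1 (Real.rpow_pos_of_pos hl0 (C - 1)).le]

/-! ### Growth of balls around the base point -/

lemma real_ball_le_exp_mul_integral_gaussian (hm : IsMetricMeasure m) (x₀ : X) {r : ℝ}
    (hr : 0 < r) (hi : Integrable (fun x => Real.exp (-(r⁻¹ ^ 2) * dist x₀ x ^ 2)) m) :
    m.real (Metric.ball x₀ r) ≤
      Real.exp 1 * ∫ x, Real.exp (-(r⁻¹ ^ 2) * dist x₀ x ^ 2) ∂m := by
  rw [← integral_const_mul, ← integral_indicator_one Metric.isOpen_ball.measurableSet]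
  refine integral_mono ?_ (hi.const_mul _) fun x => ?_
  · exact (integrable_indicator_iff Metric.isOpen_ball.measurableSet).2
      (integrableOn_const (hm.ball_lt_top x₀ r).ne)
  · refine Set.indicator_apply_le' (fun hx => ?_) (fun _ => by positivity)
    rw [← Real.exp_add]
    refine Real.one_le_exp ?_
    rw [Metric.mem_ball, dist_comm] at hx
    have h1 : r⁻¹ * dist x₀ x ≤ 1 := by
      rw [inv_mul_le_iff₀ hr]; linarith
    have h2 := pow_le_one₀ (n := 2) (by positivity) h1
    rw [mul_pow] at h2
    linarith

lemma VD.integral_gaussian_le {D γ : ℝ} (h : VD m D γ) (hm : IsMetricMeasure m) (hD : 1 ≤ D)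
    (x₀ : X) {r : ℝ} (hr : 0 < r) :
    ∫ x, Real.exp (-(r⁻¹ ^ 2) * dist x₀ x ^ 2) ∂m ≤
      (∑' n : ℕ, Real.exp (-(n : ℝ) ^ 2) * ((n : ℝ) + 1) ^ γ) * D * m.real (Metric.ball x₀ r) := by
  have h0 : 0 ≤ ∑' n : ℕ, Real.exp (-(n : ℝ) ^ 2) * ((n : ℝ) + 1) ^ γ :=
    tsum_nonneg fun n => by positivity
  have hD0 : 0 ≤ D := by linarith
  rw [← ENNReal.ofReal_le_ofReal_iff (by positivity), ofReal_integral_eq_lintegral_ofReal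
    (h.integrable_gaussian hm hD x₀ (by positivity)) (ae_of_all _ fun x => by positivity)]
  refine (le_of_eq ?_).trans (h.lintegral_gaussian_le hm hD x₀ hr)
  congr! 4 with x
  rw [div_eq_inv_mul, mul_pow, neg_mul]

/-- Up to a constant, the mass of balls around `x₀` grows at least like `r ^ (2 * C)`: at the scale
`r` it is comparable from above and below with the Gaussian integral at `l = r⁻²`. -/
lemma exists_real_ball_le_mul_rpow_mul_real_ball {D γ C : ℝ} {x₀ : X} (hVD : VD m D γ)
    (hm : IsMetricMeasure m) (hD : 1 ≤ D) (hC : 0 < C) (h : CKN m C x₀ 0) :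
    ∃ K : ℝ, 0 < K ∧ ∀ r s : ℝ, 0 < r → r ≤ s →
      m.real (Metric.ball x₀ r) ≤ K * (r / s) ^ (2 * C) * m.real (Metric.ball x₀ s) := by
  set S := ∑' n : ℕ, Real.exp (-(n : ℝ) ^ 2) * ((n : ℝ) + 1) ^ γ
  have hS : 0 < S := (summable_exp_neg_sq_mul_rpow γ).tsum_pos (fun n => by positivity) 0
    (by positivity)
  have hD0 : 0 < D := by linarith
  refine ⟨Real.exp 1 * (S * D), by positivity, fun r s hr hrs => ?_⟩
  have hs := hr.trans_le hrs
  have h1 := antitoneOn_rpow_mul_integral_gaussian hVD hm hD hC h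
    (a := s⁻¹ ^ 2) (b := r⁻¹ ^ 2) (Set.mem_Ioi.2 (by positivity)) (Set.mem_Ioi.2 (by positivity))
    (by gcongr)
  have h2 := real_ball_le_exp_mul_integral_gaussian hm x₀ hr
    (hVD.integrable_gaussian hm hD x₀ (by positivity))
  have h3 := hVD.integral_gaussian_le hm hD x₀ hs
  have hp : ∀ t : ℝ, 0 < t → (t⁻¹ ^ 2) ^ C = (t ^ (2 * C))⁻¹ := fun t ht => by
    rw [inv_pow, Real.inv_rpow (by positivity), ← Real.rpow_natCast, ← Real.rpow_mul ht.le]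
    norm_num
  simp only [hp r hr, hp s hs] at h1
  have hrC : 0 < r ^ (2 * C) := by positivity
  rw [inv_mul_le_iff₀ hrC] at h1
  rw [Real.div_rpow hr.le hs.le]
  calc _ ≤ _ := h2
    _ ≤ Real.exp 1 * (r ^ (2 * C) * ((s ^ (2 * C))⁻¹ * (S * D * m.real (Metric.ball x₀ s)))) := by
        gcongr
        exact h1.trans (by gcongr)
    _ = _ := by ring

end

/-! ### Comparison of the exponents -/

lemma le_of_frequently_mul_rpow_le {a b p q : ℝ} (ha : 0 < a)
    (h : ∃ᶠ r : ℝ in 𝓝[>] 0, a * r ^ p ≤ b * r ^ q) : q ≤ p := by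
  by_contra! hpq
  have ht : Tendsto (fun r : ℝ => b * r ^ (q - p)) (𝓝[>] 0) (𝓝 0) := by
    have h1 := (Real.continuousAt_rpow_const 0 (q - p) (Or.inr (by linarith))).tendsto
    rw [Real.zero_rpow (by linarith)] at h1
    simpa using (h1.mono_left nhdsWithin_le_nhds).const_mul b
  refine h ?_
  filter_upwards [ht.eventually_lt_const ha, self_mem_nhdsWithin] with r hr hr0
  have hr0' : (0 : ℝ) < r := hr0
  rw [Real.rpow_sub hr0', ← mul_div_assoc, div_lt_iff₀ (by positivity)] at hr
  exact not_le.2 hr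

section

variable {X : Type*} [MetricSpace X] [MeasurableSpace X] {m : Measure X}

lemma AR.eventually_le {x₀ : X} {β c : ℝ} (h : AR m x₀ β c) (hm : IsMetricMeasure m) :
    ∀ᶠ r : ℝ in 𝓝[>] 0, c / 2 * r ^ β ≤ m.real (Metric.ball x₀ r) := by
  have hc := h.1
  have h1 : ENNReal.ofReal (c / 2) <
      liminf (fun r : ℝ => m (Metric.ball x₀ r) / ENNReal.ofReal (r ^ β)) (𝓝[>] 0) := by
    rw [h.2]; exact (ENNReal.ofReal_lt_ofReal_iff hc).2 (by linarith)
  filter_upwards [eventually_lt_of_lt_liminf h1, self_mem_nhdsWithin] with r hr hr0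
  have hr0' : (0 : ℝ) < r := hr0
  have hb : 0 < r ^ β := by positivity
  rw [ENNReal.lt_div_iff_mul_lt (Or.inl (by simpa using hb)) (Or.inl ENNReal.ofReal_ne_top),
    ← ENNReal.ofReal_mul (by positivity)] at hr
  exact (ENNReal.ofReal_le_iff_le_toReal (hm.ball_lt_top x₀ r).ne).1 hr.le

/-- Only a frequent bound is available, since the hypothesis concerns a lower limit. -/
lemma AR.frequently_le {x₀ : X} {β c : ℝ} (h : AR m x₀ β c) :
    ∃ᶠ r : ℝ in 𝓝[>] 0, m.real (Metric.ball x₀ r) ≤ 2 * c * r ^ β := by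
  have hc := h.1
  have h1 : liminf (fun r : ℝ => m (Metric.ball x₀ r) / ENNReal.ofReal (r ^ β)) (𝓝[>] 0) <
      ENNReal.ofReal (2 * c) := by
    rw [h.2]; exact (ENNReal.ofReal_lt_ofReal_iff (by linarith)).2 (by linarith)
  refine ((frequently_lt_of_liminf_lt (by isBoundedDefault) h1).and_eventually
    self_mem_nhdsWithin).mono ?_
  rintro r ⟨hr, hr0⟩
  have hr0' : (0 : ℝ) < r := hr0
  have hb : 0 < r ^ β := by positivity
  rw [ENNReal.div_lt_iff (Or.inl (by simpa using hb)) (Or.inl ENNReal.ofReal_ne_top),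
    ← ENNReal.ofReal_mul (by positivity)] at hr
  exact ENNReal.toReal_le_of_le_ofReal (by positivity) hr.le

lemma VD.exponent_le {x₀ : X} {D γ β c : ℝ} (h : VD m D γ) (hm : IsMetricMeasure m)
    (hD : 1 ≤ D) (hAR : AR m x₀ β c) : β ≤ γ := by
  have hD0 : 0 ≤ D := by linarith
  refine le_of_frequently_mul_rpow_le (a := m.real (Metric.ball x₀ 1)) (b := D * (2 * c))
    (hm.real_ball_pos x₀ one_pos) ?_
  have hlt : ∀ᶠ r : ℝ in 𝓝[>] 0, r ∈ Set.Ioo (0 : ℝ) 1 := Ioo_mem_nhdsGT one_pos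
  refine (hAR.frequently_le.and_eventually hlt).mono ?_
  rintro r ⟨hr, hr0, hr1⟩
  have h1 := h.le_mul x₀ hr0 hr1
  have h2 : 0 < r ^ γ := by positivity
  rw [one_div, Real.inv_rpow hr0.le, mul_right_comm, ← div_eq_mul_inv, le_div_iff₀ h2] at h1
  refine h1.trans ?_
  rw [mul_assoc]
  gcongr

end

section

variable {X : Type*} [MetricSpace X] [MeasurableSpace X] [BorelSpace X] {m : Measure X}

lemma two_mul_le_exponent {x₀ : X} {D γ C β c : ℝ} (hVD : VD m D γ) (hm : IsMetricMeasure m)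
    (hD : 1 ≤ D) (hC : 0 < C) (h : CKN m C x₀ 0) (hAR : AR m x₀ β c) : 2 * C ≤ β := by
  obtain ⟨K, -, hK⟩ := exists_real_ball_le_mul_rpow_mul_real_ball hVD hm hD hC h
  refine le_of_frequently_mul_rpow_le (a := c / 2) (b := K * m.real (Metric.ball x₀ 1))
    (half_pos hAR.1) ?_
  have hlt : ∀ᶠ r : ℝ in 𝓝[>] 0, r ∈ Set.Ioo (0 : ℝ) 1 := Ioo_mem_nhdsGT one_pos
  refine ((hAR.eventually_le hm).and hlt).frequently.mono ?_
  rintro r ⟨hr, hr0, hr1⟩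
  have h1 := hK r 1 hr0 hr1.le
  rw [div_one, mul_right_comm] at h1
  exact hr.trans h1

/-- The lower bound for balls centred at `x₀`: below a small radius it is the Ahlfors-type
condition, and from that radius on it is the growth forced by the
Caffarelli--Kohn--Nirenberg inequality. -/
lemma exists_le_real_ball_self {x₀ : X} {D γ C β c : ℝ} (hVD : VD m D γ) (hm : IsMetricMeasure m)
    (hD : 1 ≤ D) (hC : 0 < C) (h : CKN m C x₀ 0) (hAR : AR m x₀ β c) :
    ∃ a : ℝ, 0 < a ∧ ∀ s : ℝ, 0 < s →
      a * (s ^ β * (1 / (1 + s) ^ (β - 2 * C))) ≤ m.real (Metric.ball x₀ s) := by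
  have hβ := two_mul_le_exponent hVD hm hD hC h hAR
  have hc := hAR.1
  obtain ⟨K, hK0, hK⟩ := exists_real_ball_le_mul_rpow_mul_real_ball hVD hm hD hC h
  obtain ⟨r₀, hr₀, hsmall⟩ := mem_nhdsGT_iff_exists_Ioc_subset.1 (hAR.eventually_le hm)
  have hr₀ : 0 < r₀ := hr₀
  set b := m.real (Metric.ball x₀ r₀) / (K * r₀ ^ (2 * C))
  have hb : 0 < b := div_pos (hm.real_ball_pos x₀ hr₀) (by positivity)
  refine ⟨min (c / 2) b, by positivity, fun s hs => ?_⟩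
  have hpos : 0 < (1 + s) ^ (β - 2 * C) := by positivity
  rcases le_total s r₀ with hsr | hsr
  · have h1 : 1 / (1 + s) ^ (β - 2 * C) ≤ 1 := by
      rw [div_le_one hpos]
      exact Real.one_le_rpow (by linarith) (by linarith)
    calc _ ≤ c / 2 * (s ^ β * 1) := by gcongr; exact min_le_left _ _
      _ = c / 2 * s ^ β := by ring
      _ ≤ _ := hsmall ⟨hs, hsr⟩
  · have h1 : s ^ β * (1 / (1 + s) ^ (β - 2 * C)) ≤ s ^ (2 * C) := by
      rw [mul_one_div, div_le_iff₀ hpos]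
      calc s ^ β = s ^ (2 * C) * s ^ (β - 2 * C) := by
            rw [← Real.rpow_add hs]; congr 1; ring
        _ ≤ _ := by
            have : 0 ≤ β - 2 * C := by linarith
            gcongr
            linarith
    have h2 := hK r₀ s hr₀ hsr
    rw [Real.div_rpow hr₀.le hs.le] at h2
    calc _ ≤ b * s ^ (2 * C) := by gcongr; exact min_le_right _ _
      _ ≤ _ := by
          rw [div_mul_eq_mul_div, div_le_iff₀ (by positivity)]
          have h3 : 0 < s ^ (2 * C) := by positivity
          calc _ ≤ _ := mul_le_mul_of_nonneg_right h2 h3.le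
            _ = _ := by field_simp

end

end MMS

theorem corollary1p3 {X : Type*} [MetricSpace X] [CompleteSpace X]
    [TopologicalSpace.SeparableSpace X] [MeasurableSpace X] [BorelSpace X]
    (m : Measure X) (hm : MMS.IsMetricMeasure m) (x₀ : X)
    (β γ D C c : ℝ) (hβ : 0 < β) (hγ : 0 < γ) (hD : 1 ≤ D) (hC : 0 < C)
    (hCKN : ∀ k : ℕ, MMS.CKN m C x₀ k)
    (hVD : MMS.VD m D γ)
    (hAR : MMS.AR m x₀ β c) :
    (2 * C ≤ β ∧ β ≤ γ) ∧
      ∃ Cs : ℝ, 0 < Cs ∧ ∀ (r : ℝ) (x : X), 0 < r →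
        m.real (Metric.ball x r) / r ^ β ≥
          Cs * (1 / (1 + r + dist x₀ x) ^ (β - 2 * C)) *
            (1 / (1 + dist x₀ x / r) ^ (γ - β)) := by
  refine ⟨⟨MMS.two_mul_le_exponent hVD hm hD hC (hCKN 0) hAR, hVD.exponent_le hm hD hAR⟩, ?_⟩
  obtain ⟨a, ha, hball⟩ := MMS.exists_le_real_ball_self hVD hm hD hC (hCKN 0) hAR
  have hD0 : 0 < D := by linarith
  refine ⟨a / (D * 2 ^ γ), by positivity, fun r x hr => ?_⟩
  have hd : 0 ≤ dist x₀ x := dist_nonneg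
  set s := r + dist x₀ x
  have hs : 0 < s := by positivity
  -- Volume growth at `x` is used up to the radius `2 * s`, where the ball around `x` contains the
  -- ball of radius `s` around `x₀`.
  have h1 := hVD.le_mul x hr (R := 2 * s) (by simp only [s]; linarith)
  have h2 : m.real (Metric.ball x₀ s) ≤ m.real (Metric.ball x (2 * s)) :=
    hm.real_ball_mono (Metric.ball_subset_ball' (by simp only [s]; linarith))
  have h3 := (hball s hs).trans (h2.trans h1)
  have h4 : 1 + dist x₀ x / r = s / r := by simp only [s]; field_simp
  have h5 : (2 * s / r) ^ γ = 2 ^ γ * ((s / r) ^ (γ - β) * (s ^ β / r ^ β)) := by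
    rw [mul_div_assoc, Real.mul_rpow two_pos.le (by positivity), ← Real.div_rpow hs.le hr.le,
      ← Real.rpow_add (by positivity), sub_add_cancel]
  rw [add_assoc, h4, ge_iff_le]
  rw [h5] at h3
  have p1 : 0 < s ^ β := by positivity
  have p2 : 0 < r ^ β := by positivity
  have p3 : 0 < (s / r) ^ (γ - β) := by positivity
  have p4 : 0 < (2 : ℝ) ^ γ := by positivity
  set q := 1 / (1 + s) ^ (β - 2 * C)
  set V := m.real (Metric.ball x r)
  set t := (s / r) ^ (γ - β)
  have h6 : a * q ≤ D * (2 ^ γ * (t / r ^ β)) * V := by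
    refine le_of_mul_le_mul_right ?_ p1
    calc _ = a * (s ^ β * q) := by ring
      _ ≤ _ := h3
      _ = _ := by ring
  calc _ = a * q * (1 / (D * 2 ^ γ * t)) := by field_simp
    _ ≤ D * (2 ^ γ * (t / r ^ β)) * V * (1 / (D * 2 ^ γ * t)) := by gcongr
    _ = _ := by field_simp
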